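/- **Theorem.** The quilts span a dg-suboperad $\mathrm{Quilt}$ of the Hadamard product $\mathrm{Word}\otimes_{\mathrm H}\mathrm{Brace}$ of the Gerstenhaber–Voronov operad and the brace operad (operads of abelian groups). That is: the subgroups $\mathrm{Quilt}(n)\subseteq \mathrm{Word}(n)\otimes_{\mathbb Z}\mathrm{Brace}(n)$ are graded subgroups, $\mathrm{Quilt}(1)$ contains the operad unit, and they are closed under the boundary $\partial$, the actions of the symmetric groups $\mathbb S_n$, and all partial compositions $\circ_a$. Here the terms are as follows. Write $\langle n\rangle=\{1,\dots,n\}$. For $m,n\ge1$ and $a\in\langle m\rangle$ let $\alpha:\langle n\rangle\to\langle n+m-1\rangle$, $\alpha(j)=j+a-1$, and let $\beta:\langle n+m-1\rangle\to\langle m\rangle$ be the weakly increasing surjection collapsing the image of $\alpha$ to $a$ and injective elsewhere. *Trees.* A tree on a finite vertex set is a planar rooted tree, given by its edges $(u,v)$ ($u$ the parent of $v$), the partial order $\le_T$ they generate (the root is least), and a partial order $\trianglelefteq_T$ (left to right) such that two vertices are $\vartriangleleft_T$-comparable iff they are $\le_T$-incomparable, and $u\vartriangleleft_T v$, $u\le_T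 u'$, $v\le_T v'$ imply $u'\vartriangleleft_T v'$. $\mathrm{Brace}(n)$ is the free abelian group on the trees with vertex set $\langle n\rangle$. For trees $S$ on $\langle m\rangle$ and $T$ on $\langle n\rangle$, $S\circ_aT$ is the sum of all trees $U$ on $\langle n+m-1\rangle$ such that $(r,s)$ is an edge of $T$ iff $(\alpha r,\alpha s)$ is an edge of $U$; $r\vartriangleleft_T s\iff\alpha r\vartriangleleft_U\alpha s$; if $(u,w)$ is an edge of $U$ then $(\beta u,\beta w)$ is an edge of $S$ or $\beta u=\beta w=a$; and $\beta u\vartriangleleft_S\beta w$ implies $u\vartriangleleft_U w$. *Words.* $\mathrm{Word}(n)$ is the free abelian group on the words $W$ over $\langle n\rangle$ in which every element of $\langle n\rangle$ occurs, with no two equal consecutive letters, and with no subsequence $u\dots v\dots u\dots v$ for $u\ne v$; it is graded by $\deg W=|W|-n$. A letter of $W$ is a caesura if the same element occurs again later. The $k$-th caesura gets the number $k$; the last occurrence of a repeated element gets the number $k+1$ if its previous occurrence is the $k$-th caesura. Then $\partial W$ is the sum over all letters that are occurrences of repeated elements of $(-1)^{\text{number}}$ times the word with that letter deleted. For words $V$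 over $\langle m\rangle$ and $W$ over $\langle n\rangle$, $V\circ_aW=\sum_X\operatorname{sgn}(X)\,X$ over all words $X$ as above over $\langle n+m-1\rangle$ such that: deleting the letters outside the image of $\alpha$ and removing consecutive repetitions gives $\alpha W$; whenever letters have been deleted between two letters in the image of $\alpha$, these two letters are equal; and applying $\beta$ and removing consecutive repetitions gives $V$. An element $v$ is interposed in $W$ if $W=\dots uv\dots u\dots$ with $u,v$ consecutive. Identify an interposed $w$ of $W$ with $\alpha w$, an interposed $v\neq a$ of $V$ with $\beta^{-1}v$, and $a$ (if interposed in $V$) with $\alpha(\text{first letter of }W)$; then $\operatorname{sgn}(X)$ is the sign of the shuffle from the interposed elements of $V$ followed by those of $W$, each in order of first occurrence, to the interposed elements of $X$ in order of first occurrence. *Hadamard product.* A permutation $\sigma\in\mathbb S_n$ acts on words and trees by replacing each label $u$ by $\sigma^{-1}(u)$. On $\mathrm{Word}(n)\otimes\mathrm{Brace}(n)$, with $(W,T)$ denoting $W\otimes T$: $\deg(W,T)=\deg W$, $\partial(W,T)=\partial W\otimes T$, $(W,T)^\sigma=(W^\sigma,T^\sigma)$, $(V,S)\circ_a(W,T)=(V\circ_aW)\otimes(S\circ_aT)$,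 and the unit is the one-letter word paired with the one-vertex tree. *Quilts.* A quilt of arity $n\geq 1$ is a pair $(W,T)$ of a basis word and a basis tree of arity $n$ such that (1) if $W=\dots u\dots v\dots$, then not $u>_Tv$; (2) if $W=\dots u\dots v\dots u\dots$, then $v\trianglelefteq_Tu$. $\mathrm{Quilt}(n)$ is the subgroup spanned by the quilts of arity $n$. -/

import Mathlib

/-
Conventions.  The label set `{1, …, n}` is represented by `Fin n = {0, …, n - 1}`.  Arities of
composable operations are positive and are written `m + 1`, `n + 1`; their partial composite has
arity `(m + 1) + (n + 1) - 1 = m + n + 1`.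
-/

namespace QuiltOperad

/-! ## Extensions of label sets -/

/-- The injection `α : {1,…,n+1} → {1,…,m+n+1}` of the extension at `a`: `α j = j + a - 1`
with labels counted from `1`, i.e. `j + a` with labels counted from `0`. -/
def extIncl {m : ℕ} (n : ℕ) (a : Fin (m + 1)) (j : Fin (n + 1)) : Fin (m + n + 1) :=
  ⟨j.val + a.val, by omega⟩

/-- The surjection `β : {1,…,m+n+1} → {1,…,m+1}` of the extension at `a`, which collapses the
image of `α` to `a`. -/
def extProj {m : ℕ} (n : ℕ) (a : Fin (m + 1)) (k : Fin (m + n + 1)) : Fin (m + 1) :=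
  if h₁ : k.val < a.val then ⟨k.val, by omega⟩
  else if k.val < a.val + (n + 1) then a
  else ⟨k.val - n, by omega⟩

/-! ## Planar rooted trees -/

/-- A planar rooted tree with vertex set `V`: an edge relation (`edge u v` says that `u` is the
parent of `v`) and a partial order `left` (written `⊴`, "to the left of or equal to"). -/
@[ext]
structure PlanarTree (V : Type) where
  edge : V → V → Prop
  left : V → V → Prop
  left_refl : ∀ u, left u u
  left_antisymm : ∀ u v, left u v → left v u → u = v
  left_trans : ∀ u v w, left u v → left v w → left u w
  edge_irrefl : ∀ u, ¬ edge u u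
  /-- The reflexive-transitive closure of the edge relation is a partial order. -/
  le_antisymm : ∀ u v, Relation.ReflTransGen edge u v → Relation.ReflTransGen edge v u → u = v
  /-- There is a unique minimal element, the root. -/
  root : ∃! r, ∀ u, Relation.ReflTransGen edge u r → u = r
  /-- No vertex lies strictly between a parent and its child. -/
  edge_minimal : ∀ u v, edge u v → ¬ ∃ t,
    (Relation.ReflTransGen edge u t ∧ u ≠ t) ∧ (Relation.ReflTransGen edge t v ∧ t ≠ v)
  /-- Two vertices are strictly comparable for `⊴` iff they are incomparable for `≤`. -/
  comparability : ∀ u v,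
    ((left u v ∧ u ≠ v) ∨ (left v u ∧ v ≠ u)) ↔
      (¬ Relation.ReflTransGen edge u v ∧ ¬ Relation.ReflTransGen edge v u)
  /-- Descendants inherit the strict left-right order. -/
  inheritance : ∀ u v u' v', (left u v ∧ u ≠ v) →
    Relation.ReflTransGen edge u u' → Relation.ReflTransGen edge v v' → (left u' v' ∧ u' ≠ v')

namespace PlanarTree

variable {V : Type} (T : PlanarTree V)

/-- The partial order `≤_T` generated by the edges (the root is the least element). -/
def le (u v : V) : Prop := Relation.ReflTransGen T.edge u v

/-- `u <_T v`. -/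
def lt (u v : V) : Prop := T.le u v ∧ u ≠ v

/-- The strict order `u ⊲_T v`. -/
def sleft (u v : V) : Prop := T.left u v ∧ u ≠ v

end PlanarTree

/-- `Tree n`: planar rooted trees with vertices labelled by `{1,…,n}`. -/
abbrev Tree (n : ℕ) : Type := PlanarTree (Fin n)

instance Tree.instFinite (n : ℕ) : Finite (Tree n) :=
  Finite.of_injective
    (fun T : Tree n => ((T.edge, T.left) : (Fin n → Fin n → Prop) × (Fin n → Fin n → Prop)))
    (fun S T h => by
      simp only [Prod.mk.injEq] at h
      exact PlanarTree.ext h.1 h.2)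

theorem PlanarTree.reflTransGen_relabel {V : Type} (e : V → V → Prop) (σ : Equiv.Perm V)
    (u v : V) : Relation.ReflTransGen (fun x y => e (σ x) (σ y)) u v ↔
      Relation.ReflTransGen e (σ u) (σ v) := by
  constructor
  · intro h
    exact Relation.ReflTransGen.lift σ (fun _ _ h => h) _ _ h
  · intro h
    have := Relation.ReflTransGen.lift (p := fun x y => e (σ x) (σ y)) σ.symm
      (fun a b (hab : e a b) => by simpa [Function.onFun] using hab) _ _ h
    simpa [Function.onFun] using this

/-- `T^σ`: every label `u` is replaced by `σ⁻¹ u`. -/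
def Tree.perm {n : ℕ} (T : Tree n) (σ : Equiv.Perm (Fin n)) : Tree n where
  edge u v := T.edge (σ u) (σ v)
  left u v := T.left (σ u) (σ v)
  left_refl u := T.left_refl _
  left_antisymm u v h₁ h₂ := σ.injective (T.left_antisymm _ _ h₁ h₂)
  left_trans u v w h₁ h₂ := T.left_trans _ _ _ h₁ h₂
  edge_irrefl u := T.edge_irrefl _
  le_antisymm u v h₁ h₂ := by
    rw [PlanarTree.reflTransGen_relabel] at h₁ h₂
    exact σ.injective (T.le_antisymm _ _ h₁ h₂)
  root := by
    obtain ⟨r, hr, huniq⟩ := T.root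
    simp only [PlanarTree.reflTransGen_relabel]
    refine ⟨σ.symm r, fun u hu => ?_, fun s hs => ?_⟩
    · rw [Equiv.apply_symm_apply] at hu
      rw [← hr _ hu, Equiv.symm_apply_apply]
    · rw [Equiv.eq_symm_apply]
      refine huniq _ fun u hu => ?_
      have := hs (σ.symm u) (by simpa using hu)
      rw [← this, Equiv.apply_symm_apply]
  edge_minimal u v h := by
    simp only [PlanarTree.reflTransGen_relabel]
    rintro ⟨t, ⟨h₁, h₂⟩, h₃, h₄⟩
    exact T.edge_minimal _ _ h ⟨σ t, ⟨h₁, σ.injective.ne h₂⟩, h₃, σ.injective.ne h₄⟩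
  comparability u v := by
    simpa only [PlanarTree.reflTransGen_relabel, σ.injective.ne_iff] using
      T.comparability (σ u) (σ v)
  inheritance u v u' v' := by
    simpa only [PlanarTree.reflTransGen_relabel, σ.injective.ne_iff] using
      T.inheritance (σ u) (σ v) (σ u') (σ v')

/-- The tree with a single vertex. -/
def Tree.unit : Tree 1 where
  edge _ _ := False
  left u v := u = v
  left_refl _ := rfl
  left_antisymm _ _ h _ := h
  left_trans _ _ _ h₁ h₂ := h₁.trans h₂
  edge_irrefl _ := id
  le_antisymm _ _ _ _ := Subsingleton.elim _ _
  root := ⟨0, fun _ _ => Subsingleton.elim _ _, fun _ _ => Subsingleton.elim _ _⟩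
  edge_minimal _ _ h := h.elim
  comparability u v := by
    obtain rfl : u = v := Subsingleton.elim u v
    simp [Relation.ReflTransGen.refl]
  inheritance u v _ _ h _ _ := (h.2 h.1).elim

/-- `U` is an extension of `S` by `T` at `a`: `T` (relabelled by `α`) is a subtree of `U`, and `S`
is the quotient of `U` (relabelled by `β`) that contracts this subtree to the vertex `a`. -/
structure IsTreeExt {m n : ℕ} (S : Tree (m + 1)) (T : Tree (n + 1)) (a : Fin (m + 1))
    (U : Tree (m + n + 1)) : Prop where
  sub_edge : ∀ r s, T.edge r s ↔ U.edge (extIncl n a r) (extIncl n a s)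
  sub_left : ∀ r s, T.sleft r s ↔ U.sleft (extIncl n a r) (extIncl n a s)
  quot_edge : ∀ u w, U.edge u w →
    S.edge (extProj n a u) (extProj n a w) ∨ (extProj n a u = a ∧ extProj n a w = a)
  quot_left : ∀ u w, S.sleft (extProj n a u) (extProj n a w) → U.sleft u w

/-- The finite set `Ext(S, T, a)` of tree extensions. -/
noncomputable def treeExt {m n : ℕ} (S : Tree (m + 1)) (T : Tree (n + 1)) (a : Fin (m + 1)) :
    Finset (Tree (m + n + 1)) :=
  (Set.toFinite {U | IsTreeExt S T a U}).toFinset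

/-! ## Words -/

/-- The condition on a word over `{1,…,n}` to be allowed: surjective, nondegenerate, and without
interlacing.  Here `List.Sublist` (`<+`) means "occurs as a (not necessarily contiguous)
subsequence", so `[u, v] <+ W` says `W = …u…v…`. -/
structure IsAllowed {n : ℕ} (W : List (Fin n)) : Prop where
  surj : ∀ a, a ∈ W
  nondeg : W.IsChain (· ≠ ·)
  noInterlace : ∀ u v, u ≠ v → ¬ [u, v, u, v].Sublist W

/-- `Word n`: the allowed words over `{1,…,n}`. -/
abbrev Word (n : ℕ) : Type := {W : List (Fin n) // IsAllowed W}

/-- Four letters at increasing positions form a subsequence. -/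
theorem sublist_four {A : Type} (l : List A) {i j k p : ℕ} (hij : i < j) (hjk : j < k)
    (hkp : k < p) (hp : p < l.length) :
    [l[i], l[j], l[k], l[p]].Sublist l := by
  have := List.map_getElem_sublist (l := l)
    (is := [⟨i, by omega⟩, ⟨j, by omega⟩, ⟨k, by omega⟩, ⟨p, hp⟩])
    (by simp [Fin.mk_lt_mk]; omega)
  simpa using this

/-- An allowed word is short: each pair of successive letters occurs at most once. -/
theorem IsAllowed.length_le {n : ℕ} {W : List (Fin n)} (h : IsAllowed W) :
    W.length ≤ n * n + 1 := by
  have hch := List.isChain_iff_getElem.1 h.nondeg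
  let f : Fin (W.length - 1) → Fin n × Fin n := fun i => (W[i.val], W[i.val + 1])
  have key : ∀ i j : Fin (W.length - 1), i < j → f i ≠ f j := by
    intro i j hij he
    simp only [f, Prod.mk.injEq] at he
    have hlt : i.val < j.val := hij
    have hi := hch i.val (by omega)
    rcases Nat.lt_or_ge (i.val + 1) j.val with h' | h'
    · have hs := sublist_four W (i := i.val) (j := i.val + 1) (k := j.val) (p := j.val + 1)
        (by omega) h' (by omega) (by omega)
      rw [← he.1, ← he.2] at hs
      exact h.noInterlace _ _ hi hs
    · have : j.val = i.val + 1 := by omega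
      simp only [this] at he
      exact hi he.1
  have hinj : Function.Injective f := by
    intro i j hf
    by_contra hne
    rcases lt_or_gt_of_ne hne with h' | h'
    · exact key i j h' hf
    · exact key j i h' hf.symm
  have := Fintype.card_le_of_injective f hinj
  simp at this
  omega

instance Word.instFinite (n : ℕ) : Finite (Word n) :=
  Set.Finite.subset (List.finite_length_le (Fin n) (n * n + 1)) (fun _ h => h.length_le)

/-- The degree `|W| - n` of a word over `{1,…,n}`. -/
def Word.deg {n : ℕ} (W : Word n) : ℤ := (W.1.length : ℤ) - n

/-- `W^σ`: every label `u` is replaced by `σ⁻¹ u`. -/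
def Word.perm {n : ℕ} (W : Word n) (σ : Equiv.Perm (Fin n)) : Word n :=
  ⟨W.1.map (σ⁻¹ : Equiv.Perm (Fin n)), by
    refine ⟨fun a => ?_, ?_, fun u v huv hs => ?_⟩
    · exact List.mem_map.2 ⟨σ a, W.2.surj _, by simp⟩
    · rw [List.isChain_map]
      exact W.2.nondeg.imp fun a b hab => (Equiv.injective _).ne hab
    · have := hs.map σ
      simp only [List.map_map, List.map_cons, List.map_nil] at this
      refine W.2.noInterlace (σ u) (σ v) (σ.injective.ne huv) ?_
      have hid : (⇑σ ∘ ⇑(σ⁻¹ : Equiv.Perm (Fin n))) = id := by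
        funext x; simp
      rwa [hid, List.map_id] at this⟩

/-- The word with a single letter. -/
def Word.unit : Word 1 :=
  ⟨[0], fun a => by simp [Subsingleton.elim a 0], by simp,
    fun u v huv _ => huv (Subsingleton.elim u v)⟩

/-! ### Boundary -/

/-- The letter at position `i` is an occurrence of a vertex that is repeated in the list `W`. -/
def Repeated {A : Type} (W : List A) (i : Fin W.length) : Prop :=
  ∃ j, j ≠ i ∧ W.get j = W.get i

/-- The letter at position `i` is a caesura: the same vertex occurs again later. -/
def Caesura {A : Type} (W : List A) (i : Fin W.length) : Prop :=
  ∃ j, i < j ∧ W.get j = W.get i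

/-- Deleting an occurrence of a repeated vertex from an allowed word gives an allowed word. -/
theorem IsAllowed.eraseIdx {n : ℕ} {W : List (Fin n)} (h : IsAllowed W) (i : Fin W.length)
    (hi : Repeated W i) : IsAllowed (W.eraseIdx i.val) := by
  obtain ⟨j, hji, hj⟩ := hi
  refine ⟨fun a => ?_, ?_, fun u v huv hs =>
    h.noInterlace u v huv (hs.trans (List.eraseIdx_sublist W i.val))⟩
  · obtain ⟨k, hk⟩ := List.mem_iff_get.1 (h.surj a)
    rw [List.mem_eraseIdx_iff_getElem]
    by_cases hki : k = i
    · exact ⟨j.val, j.2, fun he => hji (Fin.ext he), by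
        rw [← hk, hki, ← hj]; rfl⟩
    · exact ⟨k.val, k.2, fun he => hki (Fin.ext he), by rw [← hk]; rfl⟩
  · have hch := List.isChain_iff_getElem.1 h.nondeg
    rw [List.isChain_iff_getElem]
    intro k hk
    have hlen := List.length_eraseIdx_of_lt i.2
    rw [List.getElem_eraseIdx, List.getElem_eraseIdx]
    have hi2 := i.2
    by_cases h1 : k < i.val
    · by_cases h2 : k + 1 < i.val
      · simpa only [h1, h2, dif_pos] using hch k (by omega)
      · simp only [h1, h2, dif_pos, dif_neg, not_false_eq_true]
        have hki : i.val = k + 1 := by omega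
        intro he
        have hne : W[k] ≠ W[i.val] := by simpa only [hki] using hch k (by omega)
        have hj' : W[j.val] = W[i.val] := hj
        have hne' : j.val ≠ i.val := fun he' => hji (Fin.ext he')
        have hjk : j.val ≠ k := by
          intro he'
          exact hne (by simpa only [he'] using hj')
        have hjk' : j.val ≠ k + 1 + 1 := by
          intro he'
          simp only [he'] at hj'
          exact hne (he.trans hj')
        rcases Nat.lt_or_ge j.val k with hlt | hge
        · have hs := sublist_four W (i := j.val) (j := k) (k := i.val) (p := k + 1 + 1)
            hlt h1 (by omega) (by omega)
          rw [hj', ← he] at hs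
          exact h.noInterlace _ _ hne.symm hs
        · have hs := sublist_four W (i := k) (j := i.val) (k := k + 1 + 1) (p := j.val)
            h1 (by omega) (by omega) j.2
          rw [hj', ← he] at hs
          exact h.noInterlace _ _ hne hs
    · have h2 : ¬ (k + 1 < i.val) := by omega
      simpa only [h1, h2, dif_neg, not_false_eq_true] using hch (k + 1) (by omega)

open Classical in
/-- The number attached to the letter at position `i`: the `k`-th caesura has number `k`; a last
occurrence whose previous occurrence is the `k`-th caesura has number `k + 1`.
(In the second branch, the caesurae counted are exactly those up to and including the
previous occurrence of the same vertex.) -/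
noncomputable def letterNumber {A : Type} (W : List A) (i : Fin W.length) : ℕ :=
  if Caesura W i then
    (Finset.univ.filter fun j : Fin W.length => Caesura W j ∧ j ≤ i).card
  else
    (Finset.univ.filter fun j : Fin W.length =>
      Caesura W j ∧ ∃ p, j ≤ p ∧ p < i ∧ W.get p = W.get i).card + 1

/-- The sign of a letter. -/
noncomputable def letterSign {A : Type} (W : List A) (i : Fin W.length) : ℤ :=
  (-1) ^ letterNumber W i

/-- The free abelian group on the words of arity `n`. -/
abbrev WordOp (n : ℕ) : Type := Word n →₀ ℤ

/-- The free abelian group on the trees of arity `n`. -/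
abbrev Brace (n : ℕ) : Type := Tree n →₀ ℤ

/-- Among the (equal) `ℤ`-module structures on the free abelian groups, use that of `Finsupp`. -/
noncomputable instance WordOp.instModule (n : ℕ) : Module ℤ (WordOp n) := Finsupp.module _ _

noncomputable instance Brace.instModule (n : ℕ) : Module ℤ (Brace n) := Finsupp.module _ _

open Classical in
/-- The face of `W` at the position `i`: delete that letter if its vertex is repeated, and `0`
otherwise. -/
noncomputable def Word.face {n : ℕ} (W : Word n) (i : Fin W.1.length) : WordOp n :=
  if h : Repeated W.1 i then Finsupp.single ⟨W.1.eraseIdx i.val, W.2.eraseIdx i h⟩ 1 else 0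

/-- The boundary operator of the word operad. -/
noncomputable def WordOp.boundary (n : ℕ) : WordOp n →ₗ[ℤ] WordOp n :=
  Finsupp.linearCombination ℤ fun W : Word n => ∑ i, letterSign W.1 i • W.face i

/-! ### Partial composition of words -/

/-- `X` is an extension of `V` by `W` at `a`. -/
structure IsWordExt {m n : ℕ} (V : Word (m + 1)) (W : Word (n + 1)) (a : Fin (m + 1))
    (X : Word (m + n + 1)) : Prop where
  /-- Deleting the vertices outside the image of `α` and eliminating consecutive repetitions gives
  `W` relabelled by `α`. -/
  sub : (X.1.filter fun x => decide (∃ j, extIncl n a j = x)).destutter (· ≠ ·)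
    = W.1.map (extIncl n a)
  /-- These repetitions occur wherever letters have been deleted. -/
  rep : ∀ (L M R : List (Fin (m + n + 1))) (s t : Fin (n + 1)),
    X.1 = L ++ extIncl n a s :: (M ++ extIncl n a t :: R) → M ≠ [] →
    (∀ x ∈ M, ¬ ∃ j, extIncl n a j = x) → s = t
  /-- Relabelling by `β` and eliminating consecutive repetitions gives `V`. -/
  quot : (X.1.map (extProj n a)).destutter (· ≠ ·) = V.1

/-- The finite set `Ext(V, W, a)` of word extensions. -/
noncomputable def wordExt {m n : ℕ} (V : Word (m + 1)) (W : Word (n + 1)) (a : Fin (m + 1)) :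
    Finset (Word (m + n + 1)) :=
  (Set.toFinite {X | IsWordExt V W a X}).toFinset

/-- `v` is interposed in `W`: `W = …uv…u…` with `u`, `v` consecutive. -/
def Interposed {A : Type} (W : List A) (v : A) : Prop :=
  ∃ (u : A) (L R : List A), W = L ++ u :: v :: R ∧ u ∈ R

open Classical in
/-- The interposed vertices of a word, listed in the order of their first occurrences. -/
noncomputable def interposedList {n : ℕ} (W : List (Fin n)) : List (Fin n) :=
  (W.reverse.dedup.reverse).filter fun v => decide (Interposed W v)

/-- The first letter of a word of positive arity. -/
def Word.first {n : ℕ} (W : Word (n + 1)) : Fin (n + 1) :=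
  W.1.head (List.ne_nil_of_mem (W.2.surj 0))

/-- The identification of the vertices `v` of `V` with vertices of an extension by `W` at `a`:
`v ≠ a` goes to its unique preimage under `β`, and `a` goes to `α w`, `w` the first letter
of `W`. -/
def extLift {m n : ℕ} (W : Word (n + 1)) (a v : Fin (m + 1)) : Fin (m + n + 1) :=
  if v.val < a.val then ⟨v.val, by omega⟩
  else if v = a then extIncl n a W.first
  else ⟨v.val + n, by omega⟩

/-- The sign of the permutation that sorts a list of distinct natural numbers. -/
def sortSign (l : List ℕ) : ℤ :=
  (-1) ^ (Finset.univ.filter fun p : Fin l.length × Fin l.length =>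
    p.1 < p.2 ∧ l.get p.2 < l.get p.1).card

/-- The sign of an extension `X` of `V` by `W` at `a`: the sign of the shuffle from the interposed
vertices of `V` followed by those of `W` (each in order of first occurrence, and identified with
vertices of `X`) to the interposed vertices of `X` in order of first occurrence in `X`. -/
noncomputable def extSign {m n : ℕ} (V : Word (m + 1)) (W : Word (n + 1)) (a : Fin (m + 1))
    (X : Word (m + n + 1)) : ℤ :=
  sortSign (((interposedList V.1).map (extLift W a) ++
    (interposedList W.1).map (extIncl n a)).map fun x => X.1.idxOf x)

/-- The partial composition `∘_a` of words, extended bilinearly. -/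
noncomputable def WordOp.comp {m n : ℕ} (a : Fin (m + 1)) :
    WordOp (m + 1) →ₗ[ℤ] WordOp (n + 1) →ₗ[ℤ] WordOp (m + n + 1) :=
  Finsupp.linearCombination ℤ fun V : Word (m + 1) =>
    Finsupp.linearCombination ℤ fun W : Word (n + 1) =>
      ∑ X ∈ wordExt V W a, extSign V W a X • Finsupp.single X (1 : ℤ)

/-- The partial composition `∘_a` of trees, extended bilinearly. -/
noncomputable def Brace.comp {m n : ℕ} (a : Fin (m + 1)) :
    Brace (m + 1) →ₗ[ℤ] Brace (n + 1) →ₗ[ℤ] Brace (m + n + 1) :=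
  Finsupp.linearCombination ℤ fun S : Tree (m + 1) =>
    Finsupp.linearCombination ℤ fun T : Tree (n + 1) =>
      ∑ U ∈ treeExt S T a, Finsupp.single U (1 : ℤ)

/-- The (right) action of a permutation on `WordOp n`. -/
noncomputable def WordOp.perm {n : ℕ} (σ : Equiv.Perm (Fin n)) : WordOp n →ₗ[ℤ] WordOp n :=
  Finsupp.lmapDomain ℤ ℤ fun W : Word n => W.perm σ

/-- The (right) action of a permutation on `Brace n`. -/
noncomputable def Brace.perm {n : ℕ} (σ : Equiv.Perm (Fin n)) : Brace n →ₗ[ℤ] Brace n :=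
  Finsupp.lmapDomain ℤ ℤ fun T : Tree n => T.perm σ

/-! ## The Hadamard product of the two operads -/

/-- The Hadamard product in arity `n`. -/
abbrev Hadamard (n : ℕ) : Type := TensorProduct ℤ (WordOp n) (Brace n)

/-- Among the (equal) `ℤ`-module structures, use that of the tensor product. -/
noncomputable instance Hadamard.instModule (n : ℕ) : Module ℤ (Hadamard n) :=
  TensorProduct.instModule

namespace Hadamard

/-- The generator `(W, T)`. -/
noncomputable def gen {n : ℕ} (W : Word n) (T : Tree n) : Hadamard n :=
  TensorProduct.tmul ℤ (Finsupp.single W (1 : ℤ)) (Finsupp.single T (1 : ℤ))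

/-- The homogeneous part of degree `d`, where `deg (W, T) = deg W`. -/
noncomputable def degreePart (n : ℕ) (d : ℤ) : Submodule ℤ (Hadamard n) :=
  Submodule.span ℤ {x | ∃ (W : Word n) (T : Tree n), W.deg = d ∧ x = gen W T}

/-- The boundary `∂(W, T) = ∂W ⊗ T`. -/
noncomputable def boundary (n : ℕ) : Hadamard n →ₗ[ℤ] Hadamard n :=
  TensorProduct.map (WordOp.boundary n) LinearMap.id

/-- The diagonal action `(W, T)^σ = (W^σ, T^σ)`. -/
noncomputable def perm {n : ℕ} (σ : Equiv.Perm (Fin n)) : Hadamard n →ₗ[ℤ] Hadamard n :=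
  TensorProduct.map (WordOp.perm σ) (Brace.perm σ)

/-- The partial composition `(V, S) ∘_a (W, T) = (V ∘_a W) ⊗ (S ∘_a T)`. -/
noncomputable def comp {m n : ℕ} (a : Fin (m + 1)) :
    Hadamard (m + 1) →ₗ[ℤ] Hadamard (n + 1) →ₗ[ℤ] Hadamard (m + n + 1) :=
  TensorProduct.map₂ (WordOp.comp a) (Brace.comp a)

/-- The operad unit. -/
noncomputable def unit : Hadamard 1 := gen Word.unit Tree.unit

end Hadamard

/-- A family of subgroups `Q n` of the Hadamard product is a dg-suboperad: it contains the operad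
unit, each `Q n` is a graded subgroup, and the family is closed under the boundary operator, the
actions of the symmetric groups, and all partial compositions. -/
structure IsDGSuboperad (Q : (n : ℕ) → Submodule ℤ (Hadamard n)) : Prop where
  unit_mem : Hadamard.unit ∈ Q 1
  graded : ∀ n, Q n = ⨆ d : ℤ, Q n ⊓ Hadamard.degreePart n d
  boundary_mem : ∀ n, ∀ x ∈ Q n, Hadamard.boundary n x ∈ Q n
  perm_mem : ∀ n, ∀ σ : Equiv.Perm (Fin n), ∀ x ∈ Q n, Hadamard.perm σ x ∈ Q n
  comp_mem : ∀ (m n : ℕ) (a : Fin (m + 1)), ∀ x ∈ Q (m + 1), ∀ y ∈ Q (n + 1),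
    Hadamard.comp a x y ∈ Q (m + n + 1)

/-! ## Quilts -/

/-- The pair `(W, T)` is a quilt. -/
structure IsQuilt {n : ℕ} (W : Word n) (T : Tree n) : Prop where
  /-- If `W = …u…v…`, then not `u >_T v`. -/
  vertical : ∀ u v, [u, v].Sublist W.1 → ¬ T.lt v u
  /-- If `W = …u…v…u…`, then `v ⊴_T u`. -/
  horizontal : ∀ u v, [u, v, u].Sublist W.1 → T.left v u

/-- The subgroup `Quilt n` of the Hadamard product spanned by the quilts of arity `n`. -/
noncomputable def Quilt (n : ℕ) : Submodule ℤ (Hadamard n) :=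
  Submodule.span ℤ {x | ∃ (W : Word n) (T : Tree n), IsQuilt W T ∧ x = Hadamard.gen W T}

end QuiltOperad

/-!
The quilt conditions on `(W, T)` only involve the subsequences `uv` and `uvu` of the word `W`, the
relation `<_T`, and the relation `⊴_T`.

*Boundary.* A face of `W` is a subsequence of `W`, so it satisfies every condition that `W` does
(`IsQuilt.of_sublist`).

*Composition.* Let `(V, S)` and `(W, T)` be quilts, `X` an extension of `V` by `W`, and `U` one of
`S` by `T`, all at `a`; then `(X, U)` is a quilt (`IsQuilt.ext`). For vertices `u ≠ v` there are
two cases. If `β u ≠ β v`, everything is read off in the quotient: `β` is monotone for `≤`, it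
reflects `⊲`, and it carries a subsequence `uv` or `uvu` of `X` to one of `V`, since removing
consecutive repetitions does not destroy subsequences without consecutive repetitions
(`sublist_destutter_of_isChain`). If `β u = β v`, both vertices lie in the image of `α`, and
everything is read off in `(W, T)`: `α` preserves `⊲` and reflects `≤`, since a path in `U`
between vertices of the image of `α` never leaves that image, its image under `β` being a monotone
sequence that starts and ends at `a`. The signs in `∂` and `∘_a` play no role, as each term is
separately a quilt.
-/

namespace QuiltOperad

/-! ### Subsequences and removal of consecutive repetitions -/

/-- Eliminating consecutive repetitions preserves the subsequences that have none themselves. -/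
theorem sublist_destutter_of_isChain {A : Type*} [DecidableEq A] {l l' : List A}
    (hl' : l'.IsChain (· ≠ ·)) (h : l'.Sublist l) : l'.Sublist (l.destutter (· ≠ ·)) := by
  cases l with
  | nil => simpa using h
  | cons a l =>
    rw [List.destutter_cons']
    induction l generalizing a l' with
    | nil => simpa using h
    | cons b l ih =>
      rw [List.destutter']
      split_ifs with hab
      · cases h with
        | cons _ h => exact (ih hl' b h).cons _
        | cons_cons _ h => exact (ih hl'.tail b h).cons_cons _
      · obtain rfl : a = b := not_not.1 hab
        cases h with
        | cons _ h => exact ih hl' a h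
        | cons_cons _ h =>
          -- The second letter of `l'` differs from `a`, so it is not matched by the second `a`.
          refine ih hl' a (List.Sublist.cons_cons a ?_)
          cases h with
          | cons _ h => exact h
          | cons_cons _ h => simp at hl'

/-! ### The maps of an extension of label sets -/

theorem extProj_extIncl {m n : ℕ} (a : Fin (m + 1)) (j : Fin (n + 1)) :
    extProj n a (extIncl n a j) = a := by
  have h : (extIncl n a j).val = j.val + a.val := rfl
  unfold extProj
  rw [dif_neg (by omega), if_pos (by omega)]

theorem extIncl_injective {m n : ℕ} (a : Fin (m + 1)) : Function.Injective (extIncl n a) := by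
  intro i j h
  simp only [extIncl, Fin.mk.injEq] at h
  exact Fin.ext (by omega)

theorem exists_extIncl_of_extProj_eq {m n : ℕ} {a : Fin (m + 1)} {k : Fin (m + n + 1)}
    (h : extProj n a k = a) : ∃ j, extIncl n a j = k := by
  have hk : a.val ≤ k.val ∧ k.val < a.val + (n + 1) := by
    unfold extProj at h
    split_ifs at h with h₁ h₂
    · have := congrArg Fin.val h
      simp only at this
      omega
    · omega
    · have := congrArg Fin.val h
      simp only at this
      omega
  exact ⟨⟨k.val - a.val, by omega⟩, Fin.ext (by simp only [extIncl]; omega)⟩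

/-- The map `β` is injective away from the fibre over `a`, which is the image of `α`. -/
theorem exists_extIncl_of_extProj_eq_extProj {m n : ℕ} {a : Fin (m + 1)}
    {u v : Fin (m + n + 1)} (huv : u ≠ v) (h : extProj n a u = extProj n a v) :
    ∃ r s, extIncl n a r = u ∧ extIncl n a s = v := by
  have key : extProj n a u = a := by
    by_contra hu
    have hv : extProj n a v ≠ a := h ▸ hu
    refine huv (Fin.ext ?_)
    unfold extProj at h hu hv
    split_ifs at h hu hv <;> first | contradiction | (rw [Fin.mk.injEq] at h; omega)
  obtain ⟨r, hr⟩ := exists_extIncl_of_extProj_eq key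
  obtain ⟨s, hs⟩ := exists_extIncl_of_extProj_eq (h ▸ key)
  exact ⟨r, s, hr, hs⟩

/-! ### Extensions of trees -/

namespace IsTreeExt

variable {m n : ℕ} {S : Tree (m + 1)} {T : Tree (n + 1)} {a : Fin (m + 1)}
  {U : Tree (m + n + 1)}

theorem le_extProj (h : IsTreeExt S T a U) {u w : Fin (m + n + 1)} (huw : U.le u w) :
    S.le (extProj n a u) (extProj n a w) := by
  induction huw with
  | refl => exact Relation.ReflTransGen.refl
  | tail _ hbc ih =>
    rcases h.quot_edge _ _ hbc with he | ⟨hb, hc⟩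
    · exact ih.tail he
    · rwa [hc.trans hb.symm]

theorem le_of_le_extIncl (h : IsTreeExt S T a U) {r s : Fin (n + 1)}
    (hrs : U.le (extIncl n a r) (extIncl n a s)) : T.le r s := by
  generalize hw : extIncl n a s = w at hrs
  induction hrs generalizing s with
  | refl =>
    rw [extIncl_injective a hw]
    exact Relation.ReflTransGen.refl
  | @tail b c hb hbc ih =>
    -- The image of `b` under `β` lies between `a` and `a`, hence `b` is in the image of `α`.
    have h₁ := h.le_extProj hb
    have h₂ := h.le_extProj (Relation.ReflTransGen.single hbc)
    rw [extProj_extIncl] at h₁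
    rw [← hw, extProj_extIncl] at h₂
    obtain ⟨t, rfl⟩ := exists_extIncl_of_extProj_eq (S.le_antisymm _ _ h₂ h₁)
    subst hw
    exact (ih rfl).tail ((h.sub_edge t s).2 hbc)

end IsTreeExt

/-! ### Extensions of words -/

namespace IsWordExt

variable {m n : ℕ} {V : Word (m + 1)} {W : Word (n + 1)} {a : Fin (m + 1)}
  {X : Word (m + n + 1)}

theorem sublist_extProj (h : IsWordExt V W a X) {l : List (Fin (m + n + 1))}
    (hl : l.Sublist X.1) (hc : (l.map (extProj n a)).IsChain (· ≠ ·)) :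
    (l.map (extProj n a)).Sublist V.1 := by
  rw [← h.quot]
  exact sublist_destutter_of_isChain hc (hl.map _)

theorem sublist_of_sublist_extIncl (h : IsWordExt V W a X) {l : List (Fin (n + 1))}
    (hl : (l.map (extIncl n a)).Sublist X.1) (hc : l.IsChain (· ≠ ·)) : l.Sublist W.1 := by
  have hf := hl.filter fun x => decide (∃ j, extIncl n a j = x)
  rw [List.filter_eq_self.2 (by simp)] at hf
  have hs := sublist_destutter_of_isChain
    ((List.isChain_map _).2 (hc.imp fun _ _ => (extIncl_injective a).ne)) hf
  rw [h.sub] at hs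
  obtain ⟨l', hl', he⟩ := List.sublist_map_iff.1 hs
  rwa [List.map_injective_iff.2 (extIncl_injective a) he]

end IsWordExt

/-! ### Operations on quilts -/

namespace IsQuilt

theorem of_sublist {n : ℕ} {W W' : Word n} {T : Tree n} (h : IsQuilt W T)
    (hs : W'.1.Sublist W.1) : IsQuilt W' T :=
  ⟨fun u v huv => h.vertical u v (huv.trans hs), fun u v huv => h.horizontal u v (huv.trans hs)⟩

theorem perm {n : ℕ} {W : Word n} {T : Tree n} (h : IsQuilt W T) (σ : Equiv.Perm (Fin n)) :
    IsQuilt (W.perm σ) (T.perm σ) := by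
  have key : ∀ l : List (Fin n), l.Sublist (W.perm σ).1 → (l.map σ).Sublist W.1 := by
    intro l hl
    simpa [Word.perm, Function.comp_def] using hl.map σ
  refine ⟨fun u v huv hlt => h.vertical _ _ (key _ huv) ⟨?_, σ.injective.ne hlt.2⟩,
    fun u v huv => h.horizontal _ _ (key _ huv)⟩
  exact (PlanarTree.reflTransGen_relabel T.edge σ v u).1 hlt.1

/-- An extension of a quilt by a quilt is a quilt. -/
theorem ext {m n : ℕ} {V : Word (m + 1)} {S : Tree (m + 1)} {W : Word (n + 1)}
    {T : Tree (n + 1)} {a : Fin (m + 1)} {X : Word (m + n + 1)} {U : Tree (m + n + 1)}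
    (hV : IsQuilt V S) (hW : IsQuilt W T) (hX : IsWordExt V W a X) (hU : IsTreeExt S T a U) :
    IsQuilt X U where
  vertical u v huv hlt := by
    by_cases hβ : extProj n a u = extProj n a v
    · obtain ⟨r, s, rfl, rfl⟩ := exists_extIncl_of_extProj_eq_extProj hlt.2.symm hβ
      have hrs : r ≠ s := fun he => hlt.2 (he ▸ rfl)
      exact hW.vertical r s (hX.sublist_of_sublist_extIncl (l := [r, s]) huv (by simpa using hrs))
        ⟨hU.le_of_le_extIncl hlt.1, hrs.symm⟩
    · exact hV.vertical _ _ (hX.sublist_extProj huv (by simpa using hβ))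
        ⟨hU.le_extProj hlt.1, Ne.symm hβ⟩
  horizontal u v huv := by
    by_cases he : u = v
    · exact he ▸ U.left_refl u
    by_cases hβ : extProj n a u = extProj n a v
    · obtain ⟨r, s, rfl, rfl⟩ := exists_extIncl_of_extProj_eq_extProj he hβ
      have hrs : r ≠ s := fun h => he (h ▸ rfl)
      have hl := hW.horizontal r s
        (hX.sublist_of_sublist_extIncl (l := [r, s, r]) huv (by simp [hrs, hrs.symm]))
      exact ((hU.sub_left s r).1 ⟨hl, hrs.symm⟩).1
    · have hl := hV.horizontal _ _ (hX.sublist_extProj huv (by simp [hβ, Ne.symm hβ]))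
      exact (hU.quot_left v u ⟨hl, Ne.symm hβ⟩).1

theorem unit : IsQuilt Word.unit Tree.unit :=
  ⟨fun _ _ _ h => h.2 (Subsingleton.elim _ _), fun _ _ _ => Subsingleton.elim _ _⟩

end IsQuilt

/-! ### The span of the quilts -/

theorem IsQuilt.gen_mem {n : ℕ} {W : Word n} {T : Tree n} (h : IsQuilt W T) :
    Hadamard.gen W T ∈ Quilt n :=
  Submodule.subset_span ⟨W, T, h, rfl⟩

theorem Hadamard.boundary_gen {n : ℕ} (W : Word n) (T : Tree n) :
    Hadamard.boundary n (Hadamard.gen W T) =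
      ∑ i, letterSign W.1 i • TensorProduct.tmul ℤ (W.face i) (Finsupp.single T (1 : ℤ)) := by
  simp only [Hadamard.boundary, Hadamard.gen, TensorProduct.map_tmul, WordOp.boundary,
    Finsupp.linearCombination_single, one_smul, LinearMap.id_apply, TensorProduct.sum_tmul,
    TensorProduct.smul_tmul']

theorem Hadamard.perm_gen {n : ℕ} (σ : Equiv.Perm (Fin n)) (W : Word n) (T : Tree n) :
    Hadamard.perm σ (Hadamard.gen W T) = Hadamard.gen (W.perm σ) (T.perm σ) := by
  simp [Hadamard.perm, Hadamard.gen, WordOp.perm, Brace.perm]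

theorem Hadamard.comp_gen {m n : ℕ} (a : Fin (m + 1)) (V : Word (m + 1)) (S : Tree (m + 1))
    (W : Word (n + 1)) (T : Tree (n + 1)) :
    Hadamard.comp a (Hadamard.gen V S) (Hadamard.gen W T) =
      ∑ X ∈ wordExt V W a, ∑ U ∈ treeExt S T a, extSign V W a X • Hadamard.gen X U := by
  simp only [Hadamard.comp, Hadamard.gen, TensorProduct.map₂_apply_tmul, TensorProduct.map_tmul,
    WordOp.comp, Brace.comp, Finsupp.linearCombination_single, one_smul, TensorProduct.sum_tmul,
    TensorProduct.tmul_sum, TensorProduct.smul_tmul']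
  exact Finset.sum_comm

theorem boundary_mem_quilt {n : ℕ} {x : Hadamard n} (hx : x ∈ Quilt n) :
    Hadamard.boundary n x ∈ Quilt n := by
  suffices Quilt n ≤ (Quilt n).comap (Hadamard.boundary n) from this hx
  refine Submodule.span_le.2 ?_
  rintro _ ⟨W, T, h, rfl⟩
  rw [SetLike.mem_coe, Submodule.mem_comap, Hadamard.boundary_gen]
  refine Submodule.sum_mem _ fun i _ => Submodule.smul_mem _ _ ?_
  unfold Word.face
  split_ifs with hi
  · exact (h.of_sublist (W' := ⟨_, W.2.eraseIdx i hi⟩) (List.eraseIdx_sublist _ _)).gen_mem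
  · rw [TensorProduct.zero_tmul]
    exact Submodule.zero_mem _

theorem perm_mem_quilt {n : ℕ} (σ : Equiv.Perm (Fin n)) {x : Hadamard n} (hx : x ∈ Quilt n) :
    Hadamard.perm σ x ∈ Quilt n := by
  suffices Quilt n ≤ (Quilt n).comap (Hadamard.perm σ) from this hx
  refine Submodule.span_le.2 ?_
  rintro _ ⟨W, T, h, rfl⟩
  rw [SetLike.mem_coe, Submodule.mem_comap, Hadamard.perm_gen]
  exact (h.perm σ).gen_mem

theorem comp_mem_quilt {m n : ℕ} (a : Fin (m + 1)) {x : Hadamard (m + 1)} {y : Hadamard (n + 1)}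
    (hx : x ∈ Quilt (m + 1)) (hy : y ∈ Quilt (n + 1)) :
    Hadamard.comp a x y ∈ Quilt (m + n + 1) := by
  suffices Submodule.map₂ (Hadamard.comp a) (Quilt (m + 1)) (Quilt (n + 1)) ≤ Quilt (m + n + 1)
    from this (Submodule.apply_mem_map₂ _ hx hy)
  rw [Quilt, Quilt, Submodule.map₂_span_span, Submodule.span_le]
  rintro _ ⟨_, ⟨V, S, hV, rfl⟩, _, ⟨W, T, hW, rfl⟩, rfl⟩
  simp only [SetLike.mem_coe, Hadamard.comp_gen]
  refine Submodule.sum_mem _ fun X hX => Submodule.sum_mem _ fun U hU =>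
    Submodule.smul_mem _ _ ?_
  exact (hV.ext hW (by simpa [wordExt] using hX) (by simpa [treeExt] using hU)).gen_mem

theorem quilt_eq_iSup_inf_degreePart (n : ℕ) :
    Quilt n = ⨆ d : ℤ, Quilt n ⊓ Hadamard.degreePart n d := by
  refine le_antisymm (Submodule.span_le.2 ?_) (iSup_le fun d => inf_le_left)
  rintro _ ⟨W, T, h, rfl⟩
  exact Submodule.mem_iSup_of_mem W.deg
    ⟨h.gen_mem, Submodule.subset_span ⟨W, T, rfl, rfl⟩⟩

end QuiltOperad

theorem mainTheorem10 : QuiltOperad.IsDGSuboperad QuiltOperad.Quilt := by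
  exact
    { unit_mem := QuiltOperad.IsQuilt.unit.gen_mem
      graded := QuiltOperad.quilt_eq_iSup_inf_degreePart
      boundary_mem := fun _ _ => QuiltOperad.boundary_mem_quilt
      perm_mem := fun _ σ _ => QuiltOperad.perm_mem_quilt σ
      comp_mem := fun _ _ a _ hx _ hy => QuiltOperad.comp_mem_quilt a hx hy }
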